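/- For $n\ge 1$ let $L_n^{8,4}$ be the linear octagonal-quadrilateral network, that is, the chain of $n$ octagons and $n$ quadrilaterals, arranged alternately, consecutive ones sharing an edge. Explicitly, its vertices are $(i,s)$ with $0\le i\le 4n$ and $s\in\{0,1\}$; its edges are $(i,s)(i+1,s)$ for $0\le i<4n$ and $s\in\{0,1\}$, together with the rungs $(i,0)(i,1)$ for $0\le i\le 4n$ with $i\equiv 0$ or $3 \pmod 4$. The Möbius network $Q_n(8,4)$ is obtained from $L_n^{8,4}$ by identifying its two end rungs in reverse, that is, $(4n,s)$ with $(0,1-s)$. The cylinder network $Q_n'(8,4)$ is obtained by identifying them in order, that is, $(4n,s)$ with $(0,s)$. Both are simple graphs with $8n$ vertices. Put $\mu=15+4\sqrt{14}$ and $\nu=15-4\sqrt{14}$. For a graph $G$ let $\tau(G)$ be its number of spanning trees and let $\Pi(G)$ be the product, with multiplicity, of the nonzero eigenvalues of its Laplacian matrix. Then for every $n\ge 1$ $$\tau(Q_n(8,4))=\frac{1}{8n}\,\Pi(Q_n(8,4))=2n(\mu^n+\nu^n+2)$$ and $$\tau(Q_n'(8,4))=\frac{1}{8n}\,\Pi(Q_n'(8,4))=2n(\mu^n+\nu^n-2).$$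 -/

import Mathlib

/-- The linear octagonal-quadrilateral network with `n` octagons and `n` quadrilaterals, arranged
alternately, consecutive ones sharing an edge.
It is a ladder with two rails, each a path on the positions `0, 1, …, 4n` (the `Bool` says which
rail), and with rungs at the positions congruent to `0` or `3` modulo `4`: the positions
`4k, …, 4k + 3` carry the octagon number `k + 1`, and the positions `4k + 3, 4k + 4` carry the
quadrilateral number `k + 1`. -/
def linearOctQuad (n : ℕ) : SimpleGraph (Fin (4 * n + 1) × Bool) where
  Adj u v :=
    (u.2 = v.2 ∧ ((u.1 : ℕ) + 1 = v.1 ∨ (v.1 : ℕ) + 1 = u.1)) ∨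
      (u.1 = v.1 ∧ u.2 ≠ v.2 ∧ ((u.1 : ℕ) % 4 = 0 ∨ (u.1 : ℕ) % 4 = 3))
  symm := ⟨by
    rintro u v (⟨h, h'⟩ | ⟨h, h', h''⟩)
    · exact Or.inl ⟨h.symm, h'.symm⟩
    · exact Or.inr ⟨h.symm, h'.symm, h ▸ h''⟩⟩
  loopless := ⟨by
    rintro u (⟨_, h | h⟩ | ⟨_, h, _⟩)
    · omega
    · omega
    · exact h rfl⟩

/-- The identification of the two end rungs (at positions `0` and `4n`) of the linear network.
The end `(4n, s)` is glued to `(0, !s)` if `twist` is true, and to `(0, s)` if it is false; every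
other vertex is kept. -/
def glueEnds (n : ℕ) [NeZero n] (twist : Bool) (v : Fin (4 * n + 1) × Bool) :
    Fin (4 * n) × Bool :=
  if h : (v.1 : ℕ) < 4 * n then (⟨v.1, h⟩, v.2)
  else (⟨0, Nat.mul_pos (by decide) (NeZero.pos n)⟩, if twist then !v.2 else v.2)

/-- The Möbius network `Q_n(8,4)`: the two end rungs of the linear network are identified in
reverse. -/
def moebiusOctQuad (n : ℕ) [NeZero n] : SimpleGraph (Fin (4 * n) × Bool) :=
  (linearOctQuad n).map (glueEnds n true)

/-- The cylinder network `Q'_n(8,4)`: the two end rungs of the linear network are identified in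
order. -/
def cylinderOctQuad (n : ℕ) [NeZero n] : SimpleGraph (Fin (4 * n) × Bool) :=
  (linearOctQuad n).map (glueEnds n false)

/-- The number of spanning trees of a graph: the number of its subgraphs on the full vertex set
which are trees. -/
noncomputable def spanningTreeCount {V : Type*} (G : SimpleGraph V) : ℕ :=
  {T : SimpleGraph V | T ≤ G ∧ T.IsTree}.ncard

open Classical in
/-- The product of the nonzero eigenvalues of the Laplacian matrix `D(G) - A(G)` over `ℝ`, counted
with multiplicity. -/
noncomputable def nonzeroLaplacianEigenvalueProd {V : Type*} [Fintype V] (G : SimpleGraph V) : ℝ :=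
  ∏ i : V with (G.isHermitian_lapMatrix ℝ).eigenvalues i ≠ 0,
    (G.isHermitian_lapMatrix ℝ).eigenvalues i

/-! Let `N = 8n`. By the matrix tree theorem every diagonal cofactor of the Laplacian `L` equals
`τ`, so the linear coefficient of its characteristic polynomial is `(-1)^(N-1) * N * τ`. When `τ ≠
0`, zero is a simple eigenvalue and the same coefficient is `(-1)^(N-1) * Π`. It remains to compute
this coefficient.

Swapping the rails is a symmetry, so the characteristic polynomial factors into a symmetric and an
antisymmetric part (`Matrix.charpoly_of_swap_symmetric`). The symmetric part is the Laplacian of the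
cycle of length `4n`; its characteristic polynomial vanishes at `0` with derivative `-(4n)^2`. The
antisymmetric part is a periodic Jacobi matrix with diagonal `4, 2, 2, 4, …` and corner sign `ε =
-1` (Möbius) or `1` (cylinder).

`det_periodicJacobi` expresses such determinants as the trace of the monodromy minus `2ε`. Over one
period of four steps the monodromy has eigenvalues `μ` and `ν`, whence the determinant `μ^n + ν^n -
2ε` and `8n * τ = (4n)^2 * (μ^n + ν^n - 2ε)`. -/

open Matrix

/-! ### Determinants attached to parent maps -/

/-- The matrix `1 - P`, where `P` sends every vertex other than the root `r` to its parent. -/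
def parentMatrix {V : Type*} [DecidableEq V] (r : V) (f : V → V) : Matrix V V ℝ :=
  fun v => if v = r then Pi.single r 1 else Pi.single v 1 - Pi.single (f v) 1

/-- `f` leads every vertex to the root `r`: some height strictly decreases along `f`. -/
def LeadsTo {V : Type*} (r : V) (f : V → V) : Prop :=
  ∃ d : V → ℕ, ∀ v, v ≠ r → d (f v) < d v

theorem leadsTo_of_forall_iterate {V : Type*} {r : V} {f : V → V}
    (h : ∀ v, ∃ k, f^[k] v = r) : LeadsTo r f := by
  classical
  refine ⟨fun v => Nat.find (h v), fun v hv => ?_⟩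
  have h1 := Nat.find_spec (h v)
  obtain ⟨k, hk⟩ : ∃ k, Nat.find (h v) = k + 1 := by
    refine Nat.exists_eq_succ_of_ne_zero fun h0 => hv ?_
    rw [h0] at h1
    exact h1
  rw [hk, Function.iterate_succ_apply] at h1
  simp only [hk]
  exact Nat.lt_succ_of_le (Nat.find_min' _ h1)

/-- Parents are strictly lower, so grouping vertices by height makes the matrix block triangular
with identity diagonal blocks. -/
theorem det_parentMatrix_of_leadsTo {V : Type*} [Fintype V] [DecidableEq V] {r : V} {f : V → V}
    (h : LeadsTo r f) : (parentMatrix r f).det = 1 := by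
  obtain ⟨d, hd⟩ := h
  have ht : (parentMatrix r f).BlockTriangular (fun v => OrderDual.toDual (d v)) := by
    intro i j hij
    have hij' : d i < d j := hij
    have hne : j ≠ i := by rintro rfl; exact lt_irrefl _ hij'
    unfold parentMatrix
    split_ifs with hi
    · subst hi; simp [hne]
    · have : j ≠ f i := by rintro rfl; exact absurd (hd i hi) (by omega)
      simp [hne, this]
  rw [ht.det]
  refine Finset.prod_eq_one fun a _ => ?_
  have : (parentMatrix r f).toSquareBlock (fun v => OrderDual.toDual (d v)) a = 1 := by
    ext ⟨i, hi⟩ ⟨j, hj⟩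
    have hij : d i = d j := by simpa using hi.trans hj.symm
    simp only [Matrix.toSquareBlock_def, Matrix.of_apply, Matrix.one_apply, Subtype.mk.injEq]
    unfold parentMatrix
    split_ifs with h1 h2 h2
    · subst h1 h2; simp
    · subst h1; simp [Ne.symm h2]
    · subst h2
      have : i ≠ f i := fun h => absurd (hd i h1) (by rw [← h]; omega)
      simp [this]
    · have : j ≠ f i := by rintro rfl; exact absurd (hd i h1) (by omega)
      simp [Ne.symm h2, this]
  rw [this, Matrix.det_one]

/-- The indicator of the vertices whose orbit never meets the root is a nonzero kernel vector. -/
theorem det_parentMatrix_of_not_leadsTo {V : Type*} [Fintype V] [DecidableEq V] {r : V}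
    {f : V → V} (h : ¬ LeadsTo r f) : (parentMatrix r f).det = 0 := by
  classical
  have h' : ∃ v, ∀ k, f^[k] v ≠ r := by
    by_contra! hc
    exact h (leadsTo_of_forall_iterate hc)
  obtain ⟨v₀, hv₀⟩ := h'
  refine Matrix.exists_mulVec_eq_zero_iff.1
    ⟨fun v => if ∀ k, f^[k] v ≠ r then 1 else 0, fun h0 => ?_, ?_⟩
  · have := congrFun h0 v₀
    simp [hv₀] at this
  · ext v
    change parentMatrix r f v ⬝ᵥ _ = 0
    simp only [parentMatrix]
    split_ifs with hv
    · subst hv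
      simp only [single_dotProduct, one_mul, ite_eq_right_iff]
      exact fun h => absurd rfl (h 0)
    · have : (∀ k, f^[k] v ≠ r) ↔ ∀ k, f^[k] (f v) ≠ r := by
        refine ⟨fun h k => h (k + 1), fun h k => ?_⟩
        cases k with
        | zero => exact hv
        | succ k => exact h k
      simp only [sub_dotProduct, single_dotProduct, this]
      simp

/-! ### Spanning trees as parent maps, and the matrix tree theorem -/

namespace SimpleGraph

variable {V : Type*}

/-- The graph of all edges from a vertex other than the root to its parent. -/
def parentGraph (r : V) (f : V → V) : SimpleGraph V :=
  SimpleGraph.fromRel fun a b => a ≠ r ∧ b = f a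

theorem parentGraph_isTree [Finite V] {r : V} {f : V → V} (h : LeadsTo r f) :
    (parentGraph r f).IsTree := by
  classical
  obtain ⟨d, hd⟩ := h
  have hadj : ∀ v, v ≠ r → (parentGraph r f).Adj v (f v) := fun v hv => by
    refine (SimpleGraph.fromRel_adj _ _ _).2 ⟨fun h => ?_, Or.inl ⟨hv, rfl⟩⟩
    have := hd v hv
    rw [← h] at this
    exact lt_irrefl _ this
  have hreach : ∀ k v, d v ≤ k → (parentGraph r f).Reachable v r := by
    intro k
    induction k with
    | zero =>
      intro v hv
      by_cases hvr : v = r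
      · rw [hvr]
      · exact absurd (hd v hvr) (by omega)
    | succ k ih =>
      intro v hv
      by_cases hvr : v = r
      · rw [hvr]
      · exact (hadj v hvr).reachable.trans (ih _ (by have := hd v hvr; omega))
  have hconn : (parentGraph r f).Connected :=
    (SimpleGraph.connected_iff_exists_forall_reachable _).2
      ⟨r, fun v => (hreach _ v le_rfl).symm⟩
  refine SimpleGraph.isTree_iff_connected_and_card.2 ⟨hconn, le_antisymm ?_
    hconn.card_vert_le_card_edgeSet_add_one⟩
  have := Fintype.ofFinite V
  have hsub : (parentGraph r f).edgeSet ⊆ (fun v => s(v, f v)) '' {v | v ≠ r} := by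
    intro e
    induction e with
    | _ a b =>
      intro he
      have he' : (parentGraph r f).Adj a b := he
      rcases ((SimpleGraph.fromRel_adj _ _ _).1 he').2 with ⟨h1, h2⟩ | ⟨h1, h2⟩
      · exact ⟨a, h1, by rw [h2]⟩
      · exact ⟨b, h1, by rw [h2, Sym2.eq_swap]⟩
  have h1 : (parentGraph r f).edgeSet.ncard ≤ ({v | v ≠ r} : Set V).ncard :=
    (Set.ncard_le_ncard hsub (Set.toFinite _)).trans (Set.ncard_image_le (Set.toFinite _))
  have h2 : ({v | v ≠ r} : Set V).ncard + 1 = Nat.card V := by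
    have : ({v | v ≠ r} : Set V) = {r}ᶜ := rfl
    rw [this, ← Set.ncard_add_ncard_compl {r}, Set.ncard_singleton, add_comm]
  rw [Nat.card_coe_set_eq]
  omega

/-- Induction on the height for `g`: if the edge from `v` to `g v` were instead the parent edge of
`g v` under `f`, then `g (g v) = v` by induction, contradicting the decrease of heights. -/
theorem parentGraph_injOn {r : V} {f g : V → V} (hf : LeadsTo r f) (hg : LeadsTo r g)
    (h : parentGraph r f = parentGraph r g) {v : V} (hv : v ≠ r) : f v = g v := by
  obtain ⟨d, hd⟩ := hf
  obtain ⟨e, he⟩ := hg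
  have hadj : ∀ v, v ≠ r → (parentGraph r f).Adj v (f v) := fun v hv => by
    refine (SimpleGraph.fromRel_adj _ _ _).2 ⟨fun h => ?_, Or.inl ⟨hv, rfl⟩⟩
    have := hd v hv
    rw [← h] at this
    exact lt_irrefl _ this
  have hadj' : ∀ v, v ≠ r → (parentGraph r g).Adj v (g v) := fun v hv => by
    refine (SimpleGraph.fromRel_adj _ _ _).2 ⟨fun h => ?_, Or.inl ⟨hv, rfl⟩⟩
    have := he v hv
    rw [← h] at this
    exact lt_irrefl _ this
  have key : ∀ k v, e v ≤ k → v ≠ r → f v = g v := by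
    intro k
    induction k with
    | zero => intro v hk hv; exact absurd (he v hv) (by omega)
    | succ k ih =>
      intro v hk hv
      by_contra hne
      have h1 := hadj' v hv
      rw [← h] at h1
      rcases ((SimpleGraph.fromRel_adj _ _ _).1 h1).2 with ⟨_, h2⟩ | ⟨h2, h3⟩
      · exact hne h2.symm
      · have h4 := ih (g v) (by have := he v hv; omega) h2
        have h5 := he v hv
        have h6 := he (g v) h2
        rw [← h4, ← h3] at h6
        omega
  exact key _ v le_rfl hv

/-- The parent is the next vertex on a shortest path to the root. The resulting connected subgraph
is all of `T`, since a tree is minimally connected. -/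
theorem IsTree.exists_parentGraph_eq [Finite V] {T : SimpleGraph V} (hT : T.IsTree) (r : V) :
    ∃ f : V → V, LeadsTo r f ∧ f r = r ∧ parentGraph r f = T ∧ ∀ v, v ≠ r → T.Adj v (f v) := by
  classical
  have hex : ∀ v, v ≠ r → ∃ w, T.Adj v w ∧ T.dist w r < T.dist v r := by
    intro v hv
    obtain ⟨p, hp⟩ := hT.connected.exists_walk_length_eq_dist v r
    cases p with
    | nil => exact absurd rfl hv
    | cons hadj q =>
      refine ⟨_, hadj, ?_⟩
      rw [← hp, SimpleGraph.Walk.length_cons]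
      exact Nat.lt_succ_of_le (SimpleGraph.dist_le q)
  choose! f hf hf' using hex
  set g : V → V := fun v => if v = r then r else f v with hg
  have hgv : ∀ v, v ≠ r → g v = f v := fun v hv => by simp [hg, hv]
  have hlead : LeadsTo r g := ⟨fun v => T.dist v r, fun v hv => by rw [hgv v hv]; exact hf' v hv⟩
  have hadj : ∀ v, v ≠ r → T.Adj v (g v) := fun v hv => by rw [hgv v hv]; exact hf v hv
  have hle : parentGraph r g ≤ T := by
    intro a b hab
    rcases ((SimpleGraph.fromRel_adj _ _ _).1 hab).2 with ⟨h1, h2⟩ | ⟨h1, h2⟩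
    · rw [h2]; exact hadj a h1
    · rw [h2]; exact (hadj b h1).symm
  refine ⟨g, hlead, by simp [hg], le_antisymm hle ?_, hadj⟩
  exact (SimpleGraph.isTree_iff_minimal_connected.1 hT).2 (parentGraph_isTree hlead).connected hle

variable [Fintype V] [DecidableEq V] (G : SimpleGraph V) [DecidableRel G.Adj]

theorem lapMatrix_row (v : V) :
    G.lapMatrix ℝ v = ∑ w ∈ G.neighborFinset v, (Pi.single v 1 - Pi.single w 1 : V → ℝ) := by
  ext u
  simp only [SimpleGraph.lapMatrix, SimpleGraph.degMatrix, Matrix.sub_apply, Finset.sum_apply,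
    Pi.sub_apply, Finset.sum_sub_distrib, Finset.sum_const, SimpleGraph.card_neighborFinset_eq_degree,
    SimpleGraph.adjMatrix_apply, Pi.single_apply, Finset.sum_ite_eq, SimpleGraph.mem_neighborFinset,
    Matrix.diagonal_apply]
  congr 1
  by_cases h : v = u <;> simp [h, eq_comm]

/-- **Matrix tree theorem**: every diagonal cofactor of the Laplacian matrix counts the spanning
trees. -/
theorem adjugate_lapMatrix_apply_self (r : V) :
    (G.lapMatrix ℝ).adjugate r r = spanningTreeCount G := by
  classical
  -- The singleton `{r}` fixes the value at the root, which `parentMatrix` ignores, so that each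
  -- tree comes from exactly one map.
  set A : V → Finset V := fun v => if v = r then {r} else G.neighborFinset v with hA
  set g : V → V → V → ℝ := fun v w => if v = r then Pi.single r 1 else
    Pi.single v 1 - Pi.single w 1 with hg
  have h1 : (G.lapMatrix ℝ).updateRow r (Pi.single r 1) = fun v => ∑ w ∈ A v, g v w := by
    funext v
    by_cases hv : v = r
    · subst hv
      rw [Matrix.updateRow_self]
      simp [hA, hg]
    · rw [Matrix.updateRow_ne hv, lapMatrix_row]
      simp [hA, hg, hv]
  -- Multilinearity in the rows: one term for each choice of a neighbour at every vertex other than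
  -- the root.
  have h2 : ((G.lapMatrix ℝ).updateRow r (Pi.single r 1)).det
      = ∑ f ∈ Fintype.piFinset A, (parentMatrix r f).det := by
    rw [h1]
    exact (Matrix.detRowAlternating (R := ℝ) (n := V)).toMultilinearMap.map_sum_finset g A
  have h3 : ∀ f : V → V, (parentMatrix r f).det = if LeadsTo r f then 1 else 0 := fun f => by
    split_ifs with h
    · exact det_parentMatrix_of_leadsTo h
    · exact det_parentMatrix_of_not_leadsTo h
  rw [Matrix.adjugate_apply, h2]
  simp only [h3]
  rw [Finset.sum_boole]
  congr 1
  rw [spanningTreeCount, ← Set.ncard_coe_finset]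
  have hmem : ∀ f : V → V, f ∈ Fintype.piFinset A ↔ f r = r ∧ ∀ v, v ≠ r → G.Adj v (f v) := by
    intro f
    rw [Fintype.mem_piFinset]
    constructor
    · intro h
      refine ⟨by simpa [hA] using h r, fun v hv => by simpa [hA, hv] using h v⟩
    · rintro ⟨h, h'⟩ v
      by_cases hv : v = r
      · subst hv; simpa [hA] using h
      · simpa [hA, hv] using h' v hv
  refine Set.ncard_congr (fun f _ => parentGraph r f) ?_ ?_ ?_
  · intro f hf
    simp only [Finset.coe_filter, Set.mem_ofPred_eq, hmem] at hf
    refine ⟨fun a b hab => ?_, parentGraph_isTree hf.2⟩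
    rcases ((SimpleGraph.fromRel_adj _ _ _).1 hab).2 with ⟨h1, h2⟩ | ⟨h1, h2⟩
    · rw [h2]; exact hf.1.2 a h1
    · rw [h2]; exact (hf.1.2 b h1).symm
  · intro f f' hf hf' h
    simp only [Finset.coe_filter, Set.mem_ofPred_eq, hmem] at hf hf'
    funext v
    by_cases hv : v = r
    · rw [hv, hf.1.1, hf'.1.1]
    · exact parentGraph_injOn hf.2 hf'.2 h hv
  · rintro T ⟨hT, hT'⟩
    obtain ⟨f, hf1, hf2, hf3, hf4⟩ := hT'.exists_parentGraph_eq r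
    refine ⟨f, ?_, hf3⟩
    simp only [Finset.coe_filter, Set.mem_ofPred_eq, hmem]
    exact ⟨⟨hf2, fun v hv => hT (hf4 v hv)⟩, hf1⟩

end SimpleGraph

/-! ### The linear coefficient of the characteristic polynomial -/

open Polynomial in
theorem Matrix.derivative_det_eq_sum {ι R : Type*} [Fintype ι] [DecidableEq ι] [CommRing R]
    (M : Matrix ι ι R[X]) :
    derivative M.det = ∑ i, (M.updateCol i fun j => derivative (M j i)).det := by
  simp only [Matrix.det_apply, derivative_sum, derivative_smul, derivative_prod_finset]
  rw [Finset.sum_comm]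
  refine Finset.sum_congr rfl fun σ _ => ?_
  rw [← Finset.smul_sum]
  congr 1
  refine Finset.sum_congr rfl fun i _ => ?_
  rw [← Finset.prod_erase_mul _ _ (Finset.mem_univ i)]
  congr 1
  · refine Finset.prod_congr rfl fun j hj => ?_
    rw [Matrix.updateCol_ne (Finset.ne_of_mem_erase hj)]
  · simp

-- Differentiating a column of `X - M` gives a basis vector, so each summand is a diagonal cofactor
-- of `-M`.
open Polynomial in
theorem Matrix.derivative_charpoly_eval_zero {ι R : Type*} [Fintype ι] [DecidableEq ι]
    [CommRing R] (M : Matrix ι ι R) :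
    (derivative M.charpoly).eval 0 = (-M).adjugate.trace := by
  rw [Matrix.charpoly, Matrix.derivative_det_eq_sum, eval_finsetSum, Matrix.trace]
  refine Finset.sum_congr rfl fun i _ => ?_
  rw [Matrix.diag_apply, ← Matrix.transpose_apply (-M).adjugate, Matrix.adjugate_transpose,
    Matrix.adjugate_apply, Matrix.updateRow_transpose, Matrix.det_transpose,
    ← coe_evalRingHom, RingHom.map_det]
  congr 1
  ext j k
  by_cases hk : k = i
  · subst hk
    by_cases hj : j = k
    · subst hj; simp
    · simp [hj]
  · simp only [RingHom.mapMatrix_apply, Matrix.map_apply, Matrix.updateCol_ne hk]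
    by_cases hj : j = k
    · subst hj; simp
    · simp [Matrix.charmatrix_apply_ne _ _ _ hj]

open Polynomial in
/-- If the derivative of the characteristic polynomial at `0` does not vanish, while the
determinant does, then it is, up to sign, the product of the nonzero eigenvalues. -/
theorem Matrix.IsHermitian.derivative_charpoly_eval_zero {ι : Type*} [Fintype ι] [DecidableEq ι]
    {M : Matrix ι ι ℝ} (hM : M.IsHermitian) (hdet : M.det = 0)
    (h0 : (derivative M.charpoly).eval 0 ≠ 0) :
    (derivative M.charpoly).eval 0 = (-1) ^ (Fintype.card ι - 1) *
      ∏ i with hM.eigenvalues i ≠ 0, hM.eigenvalues i := by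
  classical
  rw [hM.det_eq_prod_eigenvalues] at hdet
  obtain ⟨i, -, hi⟩ := Finset.prod_eq_zero_iff.1 hdet
  have hi : hM.eigenvalues i = 0 := by simpa using hi
  have key : (derivative M.charpoly).eval 0
      = ∑ j, ∏ k ∈ Finset.univ.erase j, (-hM.eigenvalues k) := by
    rw [hM.charpoly_eq, derivative_prod_finset, eval_finsetSum]
    refine Finset.sum_congr rfl fun j _ => ?_
    simp [eval_prod]
  have key2 : (derivative M.charpoly).eval 0
      = ∏ k ∈ Finset.univ.erase i, (-hM.eigenvalues k) := by
    rw [key]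
    refine Finset.sum_eq_single i (fun j _ hj => ?_) (by simp)
    exact Finset.prod_eq_zero (Finset.mem_erase.2 ⟨hj.symm, Finset.mem_univ i⟩) (by simp [hi])
  -- A second zero eigenvalue would kill the remaining product, so `i` is the only one.
  have hfil : Finset.univ.erase i = Finset.univ.filter fun j => hM.eigenvalues j ≠ 0 := by
    ext j
    simp only [Finset.mem_erase, Finset.mem_univ, and_true, Finset.mem_filter, true_and]
    refine ⟨fun hj h => h0 ?_, fun h hj => h (hj ▸ hi)⟩
    rw [key2]
    exact Finset.prod_eq_zero (Finset.mem_erase.2 ⟨hj, Finset.mem_univ j⟩) (by simp [h])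
  rw [key2, Finset.prod_neg, Finset.card_erase_of_mem (Finset.mem_univ i), Finset.card_univ, hfil]

open Polynomial in
/-- The product of the nonzero Laplacian eigenvalues and the number of spanning trees, read off
from the derivative of the characteristic polynomial at `0`. -/
theorem SimpleGraph.derivative_charpoly_lapMatrix {V : Type*} [Fintype V] [DecidableEq V]
    (G : SimpleGraph V) [DecidableRel G.Adj] :
    (derivative (G.lapMatrix ℝ).charpoly).eval 0
      = (-1) ^ (Fintype.card V - 1) * (Fintype.card V * spanningTreeCount G) := by
  rw [Matrix.derivative_charpoly_eval_zero, ← neg_one_smul ℝ (G.lapMatrix ℝ),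
    Matrix.adjugate_smul, Matrix.trace_smul, Matrix.trace]
  simp only [Matrix.diag_apply, SimpleGraph.adjugate_lapMatrix_apply_self]
  simp

open Polynomial in
theorem SimpleGraph.nonzeroLaplacianEigenvalueProd_eq {V : Type*} [Fintype V] [Nonempty V]
    (G : SimpleGraph V) (h : spanningTreeCount G ≠ 0) :
    nonzeroLaplacianEigenvalueProd G = Fintype.card V * spanningTreeCount G := by
  classical
  have h1 := G.derivative_charpoly_lapMatrix
  have h2 := (G.isHermitian_lapMatrix ℝ).derivative_charpoly_eval_zero G.det_lapMatrix_eq_zero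
    (by rw [h1]; simp [h])
  rw [h1] at h2
  have h3 := mul_left_cancel₀ (by simp) h2
  rw [h3, nonzeroLaplacianEigenvalueProd]

/-! ### Determinants of periodic Jacobi matrices -/

/-- The `m × m` periodic Jacobi matrix with diagonal `a`, off-diagonal entries `-1` and corner
entries `-ε`. -/
def periodicJacobi {R : Type*} [CommRing R] (m : ℕ) (a : ℕ → R) (ε : R) :
    Matrix (Fin m) (Fin m) R := fun i j =>
  if i = j then a i else if (i : ℕ) + 1 = j ∨ (j : ℕ) + 1 = i then -1
  else if ((i : ℕ) = 0 ∧ (j : ℕ) + 1 = m) ∨ ((j : ℕ) = 0 ∧ (i : ℕ) + 1 = m) then -ε else 0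

/-- The solution of `x (i + 2) = a (i + 1) * x (i + 1) - x i` with given initial values. -/
def jacobiSol {R : Type*} [CommRing R] (a : ℕ → R) (x y : R) : ℕ → R
  | 0 => x
  | 1 => y
  | i + 2 => a (i + 1) * jacobiSol a x y (i + 1) - jacobiSol a x y i

theorem jacobiSol_wronskian {R : Type*} [CommRing R] (a : ℕ → R) (i : ℕ) :
    jacobiSol a 1 0 i * jacobiSol a 0 1 (i + 1) - jacobiSol a 0 1 i * jacobiSol a 1 0 (i + 1)
      = 1 := by
  induction i with
  | zero => simp [jacobiSol]
  | succ i ih =>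
    rw [show i + 1 + 1 = i + 2 from rfl, jacobiSol, jacobiSol]
    linear_combination ih

/-- The trace of the monodromy of the recurrence over `m` steps. -/
def jacobiTrace {R : Type*} [CommRing R] (m : ℕ) (a : ℕ → R) : R :=
  jacobiSol a 1 0 m + jacobiSol a 0 1 (m + 1)

/-- The rows of the periodic Jacobi matrix, shifted down by one. -/
def shiftedJacobi {R : Type*} [CommRing R] (k : ℕ) (a : ℕ → R) (ε : R) :
    Matrix (Fin (k + 2)) (Fin (k + 2)) R := fun i =>
  if (i : ℕ) = 0 then
    Pi.single ⟨k + 1, by omega⟩ (a (k + 1)) - Pi.single ⟨k, by omega⟩ 1 - Pi.single 0 ε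
  else if (i : ℕ) = 1 then
    Pi.single 0 (a 0) - Pi.single 1 1 - Pi.single ⟨k + 1, by omega⟩ ε
  else Pi.single ⟨i - 1, by omega⟩ (a (i - 1)) - Pi.single ⟨i - 2, by omega⟩ 1 - Pi.single i 1

theorem periodicJacobi_eq_submatrix {R : Type*} [CommRing R] (k : ℕ) (hk : 1 ≤ k) (a : ℕ → R)
    (ε : R) :
    periodicJacobi (k + 2) a ε = (shiftedJacobi k a ε).submatrix (finRotate (k + 2)) id := by
  ext i j
  rw [Matrix.submatrix_apply, finRotate_apply, id]
  obtain ⟨i, hi⟩ := i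
  obtain ⟨j, hj⟩ := j
  by_cases h : i = k + 1
  · subst h
    have h0 : (⟨k + 1, hi⟩ + 1 : Fin (k + 2)) = 0 := Fin.last_add_one (k + 1)
    rw [h0, shiftedJacobi, if_pos (by simp)]
    simp only [periodicJacobi, Pi.sub_apply, Pi.single_apply, Fin.ext_iff, Fin.val_zero]
    split_ifs <;> first | omega | (simp; done) | grind
  · have h1 : (⟨i, hi⟩ + 1 : Fin (k + 2)) = ⟨i + 1, by omega⟩ := by
      ext
      rw [Fin.val_add_one_of_lt]
      rw [Fin.lt_def]
      simp only [Fin.val_last]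
      omega
    rw [h1]
    by_cases hi0 : i = 0
    · subst hi0
      rw [shiftedJacobi, if_neg (by simp), if_pos (by simp)]
      simp only [periodicJacobi, Pi.sub_apply, Pi.single_apply, Fin.ext_iff, Fin.val_zero,
        Fin.val_one]
      split_ifs <;> first | omega | (simp; done) | grind
    · rw [shiftedJacobi, if_neg (by simp), if_neg (by simpa using hi0)]
      simp only [periodicJacobi, Pi.sub_apply, Pi.single_apply, Fin.ext_iff]
      split_ifs <;> first | omega | simp

/-- The identity matrix with the first two columns replaced by the fundamental solutions. -/
def fundamentalMatrix {R : Type*} [CommRing R] (k : ℕ) (a : ℕ → R) :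
    Matrix (Fin (k + 2)) (Fin (k + 2)) R := fun i j =>
  if (j : ℕ) = 0 then jacobiSol a 1 0 i else if (j : ℕ) = 1 then jacobiSol a 0 1 i
  else if i = j then 1 else 0

theorem det_fundamentalMatrix {R : Type*} [CommRing R] (k : ℕ) (a : ℕ → R) :
    (fundamentalMatrix k a).det = 1 := by
  rw [Matrix.det_of_isLowerTriangular]
  · refine Finset.prod_eq_one fun i _ => ?_
    unfold fundamentalMatrix
    split_ifs with h h h'
    · rw [h]; rfl
    · rw [h]; rfl
    · rfl
    · exact absurd rfl h'
  · intro i j hij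
    have hij : (i : ℕ) < j := hij
    unfold fundamentalMatrix
    split_ifs with h h h'
    · omega
    · have : (i : ℕ) = 0 := by omega
      rw [this]; rfl
    · exact absurd (congrArg Fin.val h') (by omega)
    · rfl

/-- After the shift, each row from index `2` on is the recurrence itself and kills both fundamental
solutions. Multiplying by `fundamentalMatrix` therefore gives a block upper triangular matrix. Its
lower block is lower triangular with diagonal `-1`; the remaining `2 × 2` determinant is evaluated
with the Wronskian and `ε ^ 2 = 1`. -/
theorem det_shiftedJacobi {R : Type*} [CommRing R] (k : ℕ) (a : ℕ → R) (ε : R)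
    (hε : ε ^ 2 = 1) (ha : a (k + 2) = a 0) :
    (shiftedJacobi k a ε).det = (-1) ^ k * (2 * ε - jacobiTrace (k + 2) a) := by
  set N := shiftedJacobi k a ε * fundamentalMatrix k a with hN
  have hdet : (shiftedJacobi k a ε).det = N.det := by
    rw [hN, Matrix.det_mul, det_fundamentalMatrix, mul_one]
  have hNapp : ∀ i j, N i j = shiftedJacobi k a ε i ⬝ᵥ fun l => fundamentalMatrix k a l j :=
    fun i j => rfl
  let e : Fin 2 ⊕ Fin k ≃ Fin (k + 2) := finSumFinEquiv.trans (finCongr (Nat.add_comm 2 k))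
  have el0 : e (Sum.inl 0) = 0 := by ext; simp [e]
  have el1 : e (Sum.inl 1) = 1 := by ext; simp [e]
  have elv : ∀ i : Fin 2, (e (Sum.inl i) : ℕ) = i := fun i => by simp [e]
  have erv : ∀ i : Fin k, (e (Sum.inr i) : ℕ) = 2 + i := fun i => by
    simp [e, Nat.add_comm]
  have hz : ∀ i j, N (e (Sum.inr i)) (e (Sum.inl j)) = 0 := by
    intro i j
    have hi := erv i
    generalize e (Sum.inr i) = i' at *
    have hs : ∀ x y : R, jacobiSol a x y i' = a (i' - 1) * jacobiSol a x y (i' - 1)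
        - jacobiSol a x y (i' - 2) := by
      intro x y
      obtain ⟨t, ht⟩ : ∃ t, (i' : ℕ) = t + 2 := ⟨i, by omega⟩
      rw [ht, jacobiSol]
      rfl
    rw [hNapp]
    simp only [shiftedJacobi]
    rw [if_neg (by omega), if_neg (by omega)]
    simp only [sub_dotProduct, single_dotProduct, fundamentalMatrix, elv]
    fin_cases j
    · simp [hs]
    · simp [hs]
  have hd : (Matrix.of fun i j => N (e (Sum.inr i)) (e (Sum.inr j))).det = (-1) ^ k := by
    rw [Matrix.det_of_isLowerTriangular]
    · have : ∀ i : Fin k, N (e (Sum.inr i)) (e (Sum.inr i)) = -1 := by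
        intro i
        have hi := erv i
        generalize e (Sum.inr i) = i' at *
        rw [hNapp]
        simp only [shiftedJacobi]
        rw [if_neg (by omega), if_neg (by omega)]
        simp only [sub_dotProduct, single_dotProduct, fundamentalMatrix, Fin.ext_iff]
        split_ifs <;> first | omega | simp
      simp [this]
    · intro i j hij
      have hij : (i : ℕ) < j := hij
      have hi := erv i
      have hj := erv j
      rw [Matrix.of_apply]
      generalize e (Sum.inr i) = i' at *
      generalize e (Sum.inr j) = j' at *
      rw [hNapp]
      simp only [shiftedJacobi]
      rw [if_neg (by omega), if_neg (by omega)]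
      simp only [sub_dotProduct, single_dotProduct, fundamentalMatrix, Fin.ext_iff]
      split_ifs <;> first | omega | simp
  have hblock : N.submatrix e e = Matrix.fromBlocks
      (Matrix.of fun i j => N (e (Sum.inl i)) (e (Sum.inl j)))
      (Matrix.of fun i j => N (e (Sum.inl i)) (e (Sum.inr j))) 0
      (Matrix.of fun i j => N (e (Sum.inr i)) (e (Sum.inr j))) := by
    ext (i | i) (j | j) <;> simp [hz]
  rw [hdet, ← Matrix.det_submatrix_equiv_self e, hblock, Matrix.det_fromBlocks_zero₂₁, hd,
    mul_comm, Matrix.det_fin_two]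
  congr 1
  have hw := jacobiSol_wronskian a (k + 2)
  have hu : ∀ x y : R, jacobiSol a x y (k + 3) = a 0 * jacobiSol a x y (k + 2)
      - jacobiSol a x y (k + 1) := by
    intro x y
    rw [show k + 3 = k + 1 + 2 from rfl, jacobiSol, ← ha]
  have hu2 : ∀ x y : R, a (k + 1) * jacobiSol a x y (k + 1) - jacobiSol a x y k
      = jacobiSol a x y (k + 2) := fun x y => rfl
  simp only [Matrix.of_apply, el0, el1, hNapp, shiftedJacobi, jacobiTrace] at hw ⊢
  simp only [Fin.val_zero, Fin.val_one, if_true, one_ne_zero, if_false, sub_dotProduct,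
    single_dotProduct, fundamentalMatrix, hu2, one_mul] at hw ⊢
  simp only [show k + 2 + 1 = k + 3 from rfl, hu] at hw ⊢
  simp only [show ∀ x y : R, jacobiSol a x y 0 = x from fun _ _ => rfl,
    show ∀ x y : R, jacobiSol a x y 1 = y from fun _ _ => rfl]
  linear_combination ε * hw + jacobiSol a 0 1 (k + 1) * hε

theorem det_periodicJacobi {R : Type*} [CommRing R] {m : ℕ} (hm : 3 ≤ m) (a : ℕ → R) (ε : R)
    (hε : ε ^ 2 = 1) (ha : a m = a 0) :
    (periodicJacobi m a ε).det = jacobiTrace m a - 2 * ε := by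
  obtain ⟨k, rfl⟩ : ∃ k, m = k + 2 := ⟨m - 2, by omega⟩
  rw [periodicJacobi_eq_submatrix k (by omega), Matrix.det_permute, sign_finRotate,
    det_shiftedJacobi k a ε hε ha]
  have : ((-1 : R) ^ k) * (-1) ^ k = 1 := by rw [← mul_pow]; simp
  simp only [show k + 2 - 1 = k + 1 from rfl, pow_succ]
  push_cast
  linear_combination (jacobiTrace (k + 2) a - 2 * ε) * this

/-! ### The symmetric part: the cycle -/

theorem jacobiSol_two (x y : ℝ) (i : ℕ) :
    jacobiSol (fun _ => (2 : ℝ)) x y i = (1 - i) * x + i * y := by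
  induction i using Nat.twoStepInduction with
  | zero => simp [jacobiSol]
  | one => simp [jacobiSol]
  | more i h1 h2 =>
    rw [jacobiSol, h1, h2]
    push_cast
    ring

theorem jacobiTrace_two (m : ℕ) : jacobiTrace m (fun _ => (2 : ℝ)) = 2 := by
  rw [jacobiTrace, jacobiSol_two, jacobiSol_two]
  push_cast
  ring

theorem map_jacobiSol {R S : Type*} [CommRing R] [CommRing S] (φ : R →+* S) (a : ℕ → R) (x y : R)
    (i : ℕ) : φ (jacobiSol a x y i) = jacobiSol (fun j => φ (a j)) (φ x) (φ y) i := by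
  induction i using Nat.twoStepInduction with
  | zero => rfl
  | one => rfl
  | more i h1 h2 => rw [jacobiSol, jacobiSol, map_sub, map_mul, h1, h2]

theorem map_jacobiTrace {R S : Type*} [CommRing R] [CommRing S] (φ : R →+* S) (a : ℕ → R)
    (m : ℕ) : φ (jacobiTrace m a) = jacobiTrace m (fun j => φ (a j)) := by
  simp [jacobiTrace, map_jacobiSol]

open Polynomial in
theorem derivative_jacobiTrace_eval_zero (m : ℕ) :
    (derivative (jacobiTrace m fun _ => (2 - X : ℝ[X]))).eval 0 = -(m : ℝ) ^ 2 := by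
  have hev : ∀ x y i, (jacobiSol (fun _ => (2 - X : ℝ[X])) (C x) (C y) i).eval 0
      = (1 - i) * x + i * y := by
    intro x y i
    rw [← coe_evalRingHom, map_jacobiSol, ← jacobiSol_two]
    simp
  -- The derivative at `0` has second difference minus the affine solution at the middle index and
  -- vanishes at `i = 0, 1`; hence these cubics.
  have key : ∀ x y : ℝ, ∀ i : ℕ,
      (derivative (jacobiSol (fun _ => (2 - X : ℝ[X])) (C x) (C y) i)).eval 0
        = (i - 2) * (i - 1) * i / 6 * x - (i - 1) * i * (i + 1) / 6 * y := by
    intro x y i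
    induction i using Nat.twoStepInduction with
    | zero => simp [jacobiSol]
    | one => simp [jacobiSol]
    | more i h1 h2 =>
      have h3 := hev x y (i + 1)
      rw [jacobiSol, derivative_sub, derivative_mul]
      simp only [eval_sub, eval_add, eval_mul, h1, h2, h3, derivative_sub, derivative_X, eval_X,
        derivative_ofNat, eval_zero, eval_one, eval_ofNat]
      push_cast
      ring
  have hu := key 1 0 m
  have hv := key 0 1 (m + 1)
  simp only [C_0, C_1] at hu hv
  rw [jacobiTrace, derivative_add, eval_add, hu, hv]
  push_cast
  ring

open Polynomial in
theorem charpoly_periodicJacobi_two {m : ℕ} (hm : 3 ≤ m) (he : Even m) :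
    (periodicJacobi m (fun _ => (2 : ℝ)) 1).charpoly
      = jacobiTrace m (fun _ => (2 - X : ℝ[X])) - 2 := by
  have h : (periodicJacobi m (fun _ => (2 : ℝ)) 1).charmatrix
      = -periodicJacobi m (fun _ => (2 - X : ℝ[X])) 1 := by
    ext1 i j
    rw [Matrix.neg_apply]
    by_cases hij : i = j
    · subst hij
      simp [Matrix.charmatrix_apply_eq, periodicJacobi, map_ofNat C 2]
    · rw [Matrix.charmatrix_apply_ne _ _ _ hij]
      simp only [periodicJacobi, if_neg hij]
      split_ifs <;> simp
  rw [Matrix.charpoly, h, Matrix.det_neg, Fintype.card_fin, he.neg_one_pow, one_mul,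
    det_periodicJacobi hm _ _ (one_pow 2) rfl, mul_one]

/-! ### The antisymmetric part: monodromy over one period -/

/-- The diagonal of the antisymmetric part of the Laplacian matrix of the networks. -/
def rungWeight (i : ℕ) : ℝ := if i % 4 = 0 ∨ i % 4 = 3 then 4 else 2

theorem jacobiSol_rungWeight (x y : ℝ) (k : ℕ) :
    jacobiSol rungWeight x y (4 * k + 4)
      = 10 * jacobiSol rungWeight x y (4 * k + 1) - 7 * jacobiSol rungWeight x y (4 * k) ∧
    jacobiSol rungWeight x y (4 * k + 5)
      = 37 * jacobiSol rungWeight x y (4 * k + 1) - 26 * jacobiSol rungWeight x y (4 * k) := by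
  have h (i : ℕ) : jacobiSol rungWeight x y (i + 2) = rungWeight (i + 1) *
    jacobiSol rungWeight x y (i + 1) - jacobiSol rungWeight x y i := rfl
  have w1 : rungWeight (4 * k + 1) = 2 := if_neg (by omega)
  have w2 : rungWeight (4 * k + 2) = 2 := if_neg (by omega)
  have w3 : rungWeight (4 * k + 3) = 4 := if_pos (by omega)
  have w4 : rungWeight (4 * k + 4) = 4 := if_pos (by omega)
  have h2 := h (4 * k)
  have h3 := h (4 * k + 1)
  have h4 := h (4 * k + 2)
  have h5 := h (4 * k + 3)
  simp only [add_assoc, Nat.reduceAdd, w1, w2, w3, w4] at h2 h3 h4 h5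
  constructor <;> linarith

/-- The one-period monodromy has rows `(-7, 10)` and `(-26, 37)`, with trace `30` and determinant
`1`. So both sides satisfy `t (k + 2) = 30 * t (k + 1) - t k`. -/
theorem jacobiTrace_rungWeight (k : ℕ) :
    jacobiTrace (4 * k) rungWeight = (15 + 4 * √14) ^ k + (15 - 4 * √14) ^ k := by
  have hs : √14 ^ 2 = (14 : ℝ) := Real.sq_sqrt (by norm_num)
  unfold jacobiTrace
  induction k using Nat.twoStepInduction with
  | zero => norm_num [jacobiSol]
  | one =>
    have hu := jacobiSol_rungWeight 1 0 0
    have hv := jacobiSol_rungWeight 0 1 0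
    have e0 : ∀ x y : ℝ, jacobiSol rungWeight x y 0 = x := fun _ _ => rfl
    have e1 : ∀ x y : ℝ, jacobiSol rungWeight x y 1 = y := fun _ _ => rfl
    simp only [mul_zero, zero_add, e0, e1] at hu hv
    simp only [mul_one, Nat.reduceAdd, hu.1, hv.2]
    ring
  | more k h1 h2 =>
    have hu := jacobiSol_rungWeight 1 0 k
    have hv := jacobiSol_rungWeight 0 1 k
    have hu' := jacobiSol_rungWeight 1 0 (k + 1)
    have hv' := jacobiSol_rungWeight 0 1 (k + 1)
    simp only [mul_add, mul_one, add_assoc, Nat.reduceAdd] at hu' hv' h2 ⊢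
    have e1 : (15 + 4 * √14) ^ (k + 2) = 30 * (15 + 4 * √14) ^ (k + 1) - (15 + 4 * √14) ^ k := by
      linear_combination (15 + 4 * √14) ^ k * 16 * hs
    have e2 : (15 - 4 * √14) ^ (k + 2) = 30 * (15 - 4 * √14) ^ (k + 1) - (15 - 4 * √14) ^ k := by
      linear_combination (15 - 4 * √14) ^ k * 16 * hs
    rw [e1, e2]
    simp only [Nat.reduceMul] at *
    linarith [hu.1, hu.2, hv.1, hv.2, hu'.1, hu'.2, hv'.1, hv'.2]

/-! ### Splitting the Laplacian of the glued networks -/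

theorem Matrix.charpoly_of_swap_symmetric {ι R : Type*} [Fintype ι] [DecidableEq ι] [CommRing R]
    (A B : Matrix ι ι R) (L : Matrix (ι × Bool) (ι × Bool) R)
    (hL : ∀ i j s t, L (i, s) (j, t) = if s = t then A i j else B i j) :
    L.charpoly = (A + B).charpoly * (A - B).charpoly := by
  let e : ι × Bool ≃ ι ⊕ ι := (Equiv.prodComm ι Bool).trans (Equiv.boolProdEquivSum ι)
  have h1 : Matrix.reindex e e L = Matrix.fromBlocks A B B A := by
    ext (i | i) (j | j) <;> simp [e, hL]
  -- A unipotent change of basis triangularizes the blocks without dividing by `2`.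
  let U : (Matrix (ι ⊕ ι) (ι ⊕ ι) R)ˣ :=
    ⟨Matrix.fromBlocks 1 0 1 1, Matrix.fromBlocks 1 0 (-1) 1,
      by simp [Matrix.fromBlocks_multiply], by simp [Matrix.fromBlocks_multiply]⟩
  have h2 : Matrix.fromBlocks A B B A
      = U.val * Matrix.fromBlocks (A + B) B 0 (A - B) * U⁻¹.val := by
    simp [U, Matrix.fromBlocks_multiply]
  rw [← Matrix.charpoly_reindex e, h1, h2, Matrix.coe_units_inv, Matrix.charpoly_units_conj,
    Matrix.charpoly_fromBlocks_zero₂₁]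

theorem glueEnds_linearOctQuad_adj (n : ℕ) [NeZero n] (twist : Bool) (i j : Fin (4 * n))
    (s t : Bool) :
    ((linearOctQuad n).map (glueEnds n twist)).Adj (i, s) (j, t) ↔
      (s = t ∧ ((i : ℕ) + 1 = j ∨ (j : ℕ) + 1 = i)) ∨
      (s = (twist ^^ t) ∧
        (((i : ℕ) = 0 ∧ (j : ℕ) + 1 = 4 * n) ∨ ((j : ℕ) = 0 ∧ (i : ℕ) + 1 = 4 * n))) ∨
      (i = j ∧ s ≠ t ∧ ((i : ℕ) % 4 = 0 ∨ (i : ℕ) % 4 = 3)) := by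
  have hn : 0 < n := NeZero.pos n
  rw [SimpleGraph.map_adj']
  have hin : ∀ (k : Fin (4 * n)) (b : Bool), glueEnds n twist (k.castSucc, b) = (k, b) := by
    intro k b
    simp [glueEnds]
  have hlast : ∀ b : Bool, glueEnds n twist (Fin.last (4 * n), b)
      = (⟨0, by omega⟩, twist ^^ b) := by
    intro b
    cases twist <;> simp [glueEnds]
  constructor
  · rintro ⟨hne, ⟨u, b⟩, ⟨v, c⟩, hadj, hu, hv⟩
    induction u using Fin.lastCases with
    | last =>
      rw [hlast] at hu
      induction v using Fin.lastCases with
      | last =>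
        rw [hlast] at hv
        simp only [linearOctQuad, Fin.val_last] at hadj
        simp only [Prod.mk.injEq] at hu hv
        obtain ⟨rfl, rfl⟩ := hu
        obtain ⟨rfl, rfl⟩ := hv
        right; right
        refine ⟨rfl, ?_, by simp⟩
        rintro h
        exact hne (by rw [h])
      | cast v =>
        rw [hin] at hv
        simp only [Prod.mk.injEq] at hu hv
        obtain ⟨rfl, rfl⟩ := hu
        obtain ⟨rfl, rfl⟩ := hv
        simp only [linearOctQuad, Fin.val_last, Fin.val_castSucc, Fin.ext_iff] at hadj
        have := v.isLt
        right; left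
        rcases hadj with ⟨rfl, h | h⟩ | ⟨h, _⟩
        · omega
        · exact ⟨rfl, Or.inl ⟨rfl, h⟩⟩
        · omega
    | cast u =>
      rw [hin] at hu
      induction v using Fin.lastCases with
      | last =>
        rw [hlast] at hv
        simp only [Prod.mk.injEq] at hu hv
        obtain ⟨rfl, rfl⟩ := hu
        obtain ⟨rfl, rfl⟩ := hv
        simp only [linearOctQuad, Fin.val_last, Fin.val_castSucc, Fin.ext_iff] at hadj
        have := u.isLt
        right; left
        rcases hadj with ⟨rfl, h | h⟩ | ⟨h, _⟩
        · exact ⟨by simp, Or.inr ⟨rfl, h⟩⟩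
        · omega
        · omega
      | cast v =>
        rw [hin] at hv
        simp only [Prod.mk.injEq] at hu hv
        obtain ⟨rfl, rfl⟩ := hu
        obtain ⟨rfl, rfl⟩ := hv
        simp only [linearOctQuad, Fin.val_castSucc, Fin.castSucc_inj] at hadj
        exact hadj.imp id Or.inr
  · rintro (⟨rfl, h⟩ | ⟨rfl, h⟩ | ⟨rfl, hst, h⟩)
    · refine ⟨fun h' => ?_, (i.castSucc, s), (j.castSucc, s), Or.inl ⟨rfl, by simpa using h⟩,
        hin _ _, hin _ _⟩
      have := congrArg (fun p => (p.1 : ℕ)) h'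
      dsimp only at this
      omega
    · rcases h with ⟨h, h'⟩ | ⟨h, h'⟩
      · refine ⟨fun h1 => ?_, (Fin.last _, t), (j.castSucc, t),
          Or.inl ⟨rfl, Or.inr (by simpa using h')⟩, ?_, hin _ _⟩
        · have := congrArg (fun p => (p.1 : ℕ)) h1
          dsimp only at this
          omega
        · rw [hlast]
          exact Prod.ext (Fin.ext h.symm) rfl
      · refine ⟨fun h1 => ?_, (i.castSucc, twist ^^ t), (Fin.last _, twist ^^ t),
          Or.inl ⟨rfl, Or.inl (by simpa using h')⟩, hin _ _, ?_⟩
        · have := congrArg (fun p => (p.1 : ℕ)) h1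
          dsimp only at this
          omega
        · rw [hlast]
          exact Prod.ext (Fin.ext h.symm) (by simp)
    · exact ⟨fun h' => hst (congrArg Prod.snd h'), (i.castSucc, s), (i.castSucc, t),
        Or.inr ⟨rfl, hst, by simpa using h⟩, hin _ _, hin _ _⟩

theorem glueEnds_linearOctQuad_degree (n : ℕ) [NeZero n] (twist : Bool) (i : Fin (4 * n))
    (s : Bool) [Fintype (((linearOctQuad n).map (glueEnds n twist)).neighborSet (i, s))] :
    ((linearOctQuad n).map (glueEnds n twist)).degree (i, s)
      = if (i : ℕ) % 4 = 0 ∨ (i : ℕ) % 4 = 3 then 3 else 2 := by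
  have hn : 0 < n := NeZero.pos n
  have hi := i.isLt
  -- `p` and `q` are the cyclic successor and predecessor; the rail changes only across the seam of
  -- a twisted gluing.
  obtain ⟨p, hp⟩ : ∃ p : Fin (4 * n) × Bool, p =
    if h : (i : ℕ) + 1 < 4 * n then (⟨i + 1, h⟩, s) else (⟨0, by omega⟩, twist ^^ s) := ⟨_, rfl⟩
  obtain ⟨q, hq⟩ : ∃ q : Fin (4 * n) × Bool, q =
    if (i : ℕ) = 0 then (⟨4 * n - 1, by omega⟩, twist ^^ s) else (⟨i - 1, by omega⟩, s) :=
    ⟨_, rfl⟩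
  have hpv : (p.1 : ℕ) = if (i : ℕ) + 1 < 4 * n then (i : ℕ) + 1 else 0 := by
    rw [hp]; split_ifs <;> rfl
  have hqv : (q.1 : ℕ) = if (i : ℕ) = 0 then 4 * n - 1 else (i : ℕ) - 1 := by
    rw [hq]; split_ifs <;> rfl
  have hp2 : p.2 = if (i : ℕ) + 1 < 4 * n then s else (twist ^^ s) := by
    rw [hp]; split_ifs <;> rfl
  have hq2 : q.2 = if (i : ℕ) = 0 then (twist ^^ s) else s := by
    rw [hq]; split_ifs <;> rfl
  have hpq : p ≠ q := by
    intro h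
    rw [h] at hpv
    rw [hpv] at hqv
    split_ifs at hqv <;> omega
  have hpi : p ≠ (i, !s) := by
    intro h
    rw [h] at hpv
    dsimp only at hpv
    split_ifs at hpv <;> omega
  have hqi : q ≠ (i, !s) := by
    intro h
    rw [h] at hqv
    dsimp only at hqv
    split_ifs at hqv <;> omega
  have hmem : ∀ x : Fin (4 * n) × Bool,
      ((linearOctQuad n).map (glueEnds n twist)).Adj (i, s) x ↔
        x = p ∨ x = q ∨ (((i : ℕ) % 4 = 0 ∨ (i : ℕ) % 4 = 3) ∧ x = (i, !s)) := by
    rintro ⟨j, t⟩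
    have hj := j.isLt
    have hb1 : (s = (twist ^^ t)) ↔ t = (twist ^^ s) := by
      cases s <;> cases t <;> cases twist <;> decide
    have hb2 : s ≠ t ↔ t = !s := by cases s <;> cases t <;> decide
    rw [glueEnds_linearOctQuad_adj, hb1, hb2]
    simp only [Prod.ext_iff, Fin.ext_iff, hpv, hqv, hp2, hq2]
    clear hp hq hpv hqv hp2 hq2 hpq hpi hqi hb1 hb2
    split_ifs <;> grind
  rw [← SimpleGraph.card_neighborFinset_eq_degree]
  split_ifs with h
  · have : ((linearOctQuad n).map (glueEnds n twist)).neighborFinset (i, s) = {p, q, (i, !s)} := by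
      ext x
      simp [hmem, h]
    rw [this, Finset.card_eq_three.2 ⟨p, q, (i, !s), hpq, hpi, hqi, rfl⟩]
  · have : ((linearOctQuad n).map (glueEnds n twist)).neighborFinset (i, s) = {p, q} := by
      ext x
      simp [hmem, h]
    rw [this, Finset.card_pair hpq]

-- The blocks are written as half sum and half difference so that `A + B` and `A - B` are the two
-- Jacobi matrices. A rung adds `1` to the degree and `-1` to `B`, hence diagonal `2` and `4`; a
-- twisted seam edge lies in `B`, hence corner sign `-1` in `A - B`.
open Classical in
theorem glueEnds_linearOctQuad_lapMatrix_apply (n : ℕ) [NeZero n] (twist : Bool)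
    (i j : Fin (4 * n)) (s t : Bool) :
    ((linearOctQuad n).map (glueEnds n twist)).lapMatrix ℝ (i, s) (j, t) =
      if s = t then
        ((1 / 2 : ℝ) • (periodicJacobi (4 * n) (fun _ => 2) 1 +
          periodicJacobi (4 * n) rungWeight (if twist then -1 else 1)) : Matrix (Fin (4 * n)) (Fin (4 * n)) ℝ) i j
      else ((1 / 2 : ℝ) • (periodicJacobi (4 * n) (fun _ => 2) 1 -
          periodicJacobi (4 * n) rungWeight (if twist then -1 else 1)) : Matrix (Fin (4 * n)) (Fin (4 * n)) ℝ) i j := by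
  have hn : 0 < n := NeZero.pos n
  have hi := i.isLt
  have hj := j.isLt
  simp only [SimpleGraph.lapMatrix, SimpleGraph.degMatrix, Matrix.sub_apply, Matrix.diagonal_apply,
    SimpleGraph.adjMatrix_apply, glueEnds_linearOctQuad_adj, glueEnds_linearOctQuad_degree,
    Matrix.smul_apply, Matrix.add_apply, periodicJacobi, rungWeight, Prod.mk.injEq, smul_eq_mul]
  by_cases hij : i = j
  · subst hij
    by_cases hst : s = t
    · subst hst
      have h1 : ¬ ((i : ℕ) + 1 = i ∨ (i : ℕ) + 1 = i) := by omega
      have h2 : ¬ (((i : ℕ) = 0 ∧ (i : ℕ) + 1 = 4 * n) ∨ ((i : ℕ) = 0 ∧ (i : ℕ) + 1 = 4 * n)) := by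
        omega
      simp only [h1, h2]
      by_cases h3 : (i : ℕ) % 4 = 0 ∨ (i : ℕ) % 4 = 3 <;> simp [h3] <;> norm_num
    · have h2 : ¬ (((i : ℕ) = 0 ∧ (i : ℕ) + 1 = 4 * n) ∨ ((i : ℕ) = 0 ∧ (i : ℕ) + 1 = 4 * n)) := by
        omega
      simp only [h2, hst]
      by_cases h3 : (i : ℕ) % 4 = 0 ∨ (i : ℕ) % 4 = 3 <;> (simp [h3, hst]; try norm_num)
  · simp only [hij, false_and, if_false, or_false]
    by_cases h1 : (i : ℕ) + 1 = j ∨ (j : ℕ) + 1 = i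
    · have h2 : ¬ (((i : ℕ) = 0 ∧ (j : ℕ) + 1 = 4 * n) ∨ ((j : ℕ) = 0 ∧ (i : ℕ) + 1 = 4 * n)) := by
        omega
      simp only [h1, h2]
      by_cases hst : s = t
      · simp [hst]
        norm_num
      · simp [hst]
    · by_cases h2 : (((i : ℕ) = 0 ∧ (j : ℕ) + 1 = 4 * n) ∨ ((j : ℕ) = 0 ∧ (i : ℕ) + 1 = 4 * n))
      · simp only [h1, h2]
        cases s <;> cases t <;> cases twist <;> norm_num
      · simp only [h1, h2]
        simp

/-! ### The counts -/

open Polynomial in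
/-- The number of spanning trees of both networks. -/
theorem spanningTreeCount_glueEnds_linearOctQuad (n : ℕ) [NeZero n] (twist : Bool) :
    (spanningTreeCount ((linearOctQuad n).map (glueEnds n twist)) : ℝ) =
      2 * n * ((15 + 4 * √14) ^ n + (15 - 4 * √14) ^ n - 2 * if twist then -1 else 1) := by
  classical
  have hn : 0 < n := NeZero.pos n
  have hm : 3 ≤ 4 * n := by omega
  have he : Even (4 * n) := ⟨2 * n, by ring⟩
  set ε : ℝ := if twist then -1 else 1 with hε
  have hε2 : ε ^ 2 = 1 := by rw [hε]; split_ifs <;> norm_num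
  have hder := SimpleGraph.derivative_charpoly_lapMatrix
    ((linearOctQuad n).map (glueEnds n twist))
  rw [Matrix.charpoly_of_swap_symmetric _ _ _ (glueEnds_linearOctQuad_lapMatrix_apply n twist),
    ← hε, ← smul_add, ← smul_sub, add_add_sub_cancel, add_sub_sub_cancel, ← two_smul ℝ,
    ← two_smul ℝ (periodicJacobi (4 * n) rungWeight ε), smul_smul, smul_smul, one_div,
    inv_mul_cancel₀ (two_ne_zero' ℝ), one_smul, one_smul, derivative_mul, eval_add, eval_mul,
    eval_mul, charpoly_periodicJacobi_two hm he] at hder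
  -- The symmetric factor vanishes at `0`, so in the product rule only its derivative contributes.
  have h0 : (jacobiTrace (4 * n) (fun _ => (2 - X : ℝ[X])) - 2).eval 0 = 0 := by
    rw [eval_sub, ← coe_evalRingHom, map_jacobiTrace]
    simp [jacobiTrace_two]
  have h1 : (derivative (jacobiTrace (4 * n) (fun _ => (2 - X : ℝ[X])) - 2)).eval 0
      = -((4 * n : ℕ) : ℝ) ^ 2 := by
    rw [derivative_sub, eval_sub, derivative_jacobiTrace_eval_zero]
    simp
  have h2 : (periodicJacobi (4 * n) rungWeight ε).charpoly.eval 0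
      = (15 + 4 * √14) ^ n + (15 - 4 * √14) ^ n - 2 * ε := by
    have h := Matrix.det_eq_sign_charpoly_coeff (periodicJacobi (4 * n) rungWeight ε)
    rw [Fintype.card_fin, he.neg_one_pow, one_mul, coeff_zero_eq_eval_zero] at h
    rw [← h, det_periodicJacobi hm _ _ hε2, jacobiTrace_rungWeight]
    simp [rungWeight]
  have hodd : Odd (Fintype.card (Fin (4 * n) × Bool) - 1) := by
    rw [Fintype.card_prod, Fintype.card_fin, Fintype.card_bool]
    exact ⟨4 * n - 1, by omega⟩
  rw [h0, h1, h2, zero_mul, add_zero, hodd.neg_one_pow, Fintype.card_prod, Fintype.card_fin,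
    Fintype.card_bool] at hder
  push_cast at hder
  have hn' : (n : ℝ) ≠ 0 := by exact_mod_cast hn.ne'
  refine mul_left_cancel₀ (mul_ne_zero (by norm_num : (8 : ℝ) ≠ 0) hn') ?_
  linear_combination hder

/-- This makes the tree count nonzero even for the cylinder, as the eigenvalue product formula
requires. -/
theorem two_lt_pow_add_pow (n : ℕ) (hn : n ≠ 0) :
    2 < (15 + 4 * √14) ^ n + (15 - 4 * √14) ^ n := by
  have hs : √14 ^ 2 = (14 : ℝ) := Real.sq_sqrt (by norm_num)
  have h1 : 0 < 15 - 4 * √14 := by nlinarith [Real.sqrt_nonneg 14]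
  have h2 : (3 : ℝ) ≤ 15 + 4 * √14 := by nlinarith [Real.sqrt_nonneg 14]
  have h3 : (3 : ℝ) ≤ (15 + 4 * √14) ^ n := h2.trans (le_self_pow₀ (by linarith) hn)
  have h4 := pow_pos h1 n
  linarith

theorem nonzeroLaplacianEigenvalueProd_glueEnds_linearOctQuad (n : ℕ) [NeZero n] (twist : Bool) :
    1 / (8 * n : ℝ) * nonzeroLaplacianEigenvalueProd ((linearOctQuad n).map (glueEnds n twist)) =
      2 * n * ((15 + 4 * √14) ^ n + (15 - 4 * √14) ^ n - 2 * if twist then -1 else 1) := by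
  have hn : 0 < n := NeZero.pos n
  have hn' : (0 : ℝ) < n := by exact_mod_cast hn
  have : Nonempty (Fin (4 * n) × Bool) := ⟨(⟨0, by omega⟩, true)⟩
  have hτ := spanningTreeCount_glueEnds_linearOctQuad n twist
  have hne : spanningTreeCount ((linearOctQuad n).map (glueEnds n twist)) ≠ 0 := by
    intro h
    rw [h, Nat.cast_zero] at hτ
    have h2 := two_lt_pow_add_pow n hn.ne'
    have h3 : (0 : ℝ) < (15 + 4 * √14) ^ n + (15 - 4 * √14) ^ n - 2 * if twist then -1 else 1 := by
      split_ifs <;> linarith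
    exact (mul_pos (by positivity) h3).ne hτ
  rw [SimpleGraph.nonzeroLaplacianEigenvalueProd_eq _ hne, ← hτ, Fintype.card_prod,
    Fintype.card_fin, Fintype.card_bool]
  push_cast
  field_simp
  ring

theorem mainTheorem3 (n : ℕ) [NeZero n] :
    ((spanningTreeCount (moebiusOctQuad n) : ℝ)
        = 2 * n * ((15 + 4 * √14) ^ n + (15 - 4 * √14) ^ n + 2) ∧
      1 / (8 * n : ℝ) * nonzeroLaplacianEigenvalueProd (moebiusOctQuad n)
        = 2 * n * ((15 + 4 * √14) ^ n + (15 - 4 * √14) ^ n + 2)) ∧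
    ((spanningTreeCount (cylinderOctQuad n) : ℝ)
        = 2 * n * ((15 + 4 * √14) ^ n + (15 - 4 * √14) ^ n - 2) ∧
      1 / (8 * n : ℝ) * nonzeroLaplacianEigenvalueProd (cylinderOctQuad n)
        = 2 * n * ((15 + 4 * √14) ^ n + (15 - 4 * √14) ^ n - 2)) := by
  have h1 := spanningTreeCount_glueEnds_linearOctQuad n true
  have h2 := spanningTreeCount_glueEnds_linearOctQuad n false
  have h3 := nonzeroLaplacianEigenvalueProd_glueEnds_linearOctQuad n true
  have h4 := nonzeroLaplacianEigenvalueProd_glueEnds_linearOctQuad n false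
  simp only [if_true, mul_neg, mul_one, sub_neg_eq_add, Bool.false_eq_true, if_false] at h1 h2 h3 h4
  exact ⟨⟨h1, h3⟩, ⟨h2, h4⟩⟩
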